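/- Write $\mathbf R^+=[0,\infty)$. Let either (S) $\omega=(\omega_i)_{i\in\mathbf N}$ be a sequence of nonnegative real numbers with $\sum_i\omega_i=1$, with $\|\cdot\|_1,\|\cdot\|_\infty$ the norms of the (real or complex) sequence spaces $\ell_1,\ell_\infty$; or (O) $\omega$ be a positive trace-class operator with trace $1$ on a separable complex Hilbert space $\mathcal H$, with $\|T\|_1=\operatorname{tr}|T|$ the trace norm, $\|\cdot\|_\infty$ the operator norm, and $(\omega_i)$ the family of nonzero eigenvalues of $\omega$, repeated according to multiplicity. Let $U(\omega)\subset\mathbf R^+\times\mathbf R^+$ be the set of pairs $(r_1,r_\infty)$ such that, for $x,y$ in the $\|\cdot\|_1$-Banach space ($\ell_1$, resp. the trace-class operators) with $x-y=\omega$, the open $\|\cdot\|_1$-ball of radius $r_1$ centred at $x$ and the open $\|\cdot\|_\infty$-ball of radius $r_\infty$ centred at $y$ do not intersect (open balls of radius $0$ are empty). Put $G(s)=\sum_i\max(0,\omega_i-s)$ for $s\ge 0$; this series converges. Then: 1. $(r_1,r_\infty)\in U(\omega)$ if and only if $r_1=0$, or $r_\infty=0$, or $r_1\le G(r_\infty)$.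 2. $\max_i\omega_i$ exists and equals $\|\omega\|_\infty$, and for every $\varepsilon>0$ only finitely many indices $i$ satisfy $\omega_i\ge\varepsilon$. 3. There is a continuous, strictly decreasing function $F:[0,1]\to\mathbf R^+$ with $F(0)=\|\omega\|_\infty$ and $F(1)=0$ such that, for $0\le t\le 1$ and $0\le s\le\|\omega\|_\infty$, $F(t)=s$ if and only if $t=G(s)$. The boundary of $U(\omega)$ in $\mathbf R^+\times\mathbf R^+$ is the graph of $F$ together with two rays on the axes: $$\partial U(\omega)=\{(t,F(t)):0\le t\le 1\}\ \cup\ \{0\}\times[\|\omega\|_\infty,\infty)\ \cup\ [1,\infty)\times\{0\}.$$ 4. $F$ is piecewise linear: if $0\le a<b\le\|\omega\|_\infty$ and no $\omega_i$ lies in $(a,b)$, then the number $n$ of indices $i$ with $\omega_i\ge b$ is finite and positive, and $F(t)=b-\frac{1}{n}\,(t-G(b))$ for all $t\in[0,1]$ with $a\le F(t)\le b$. -/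

import Mathlib

open scoped NNReal ENNReal InnerProductSpace

noncomputable section

namespace EntropyNote

/-! ### Sequences -/

section Sequences

/-- Probability sequences: nonnegative real sequences with sum `1`. -/
structure IsProbSeq (ω : ℕ → ℝ) : Prop where
  nonneg : ∀ i, 0 ≤ ω i
  hasSum_one : HasSum ω 1

/-- The open ball of radius `r` around the sequence `c`, for the norm of `ℓ^p`. -/
def seqBall {𝕜 : Type*} [RCLike 𝕜] (p : ℝ≥0∞) (c : ℕ → 𝕜) (r : ℝ≥0) : Set (ℕ → 𝕜) :=
  {z | ∃ h : Memℓp (fun i => z i - c i) p,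
    ‖(⟨fun i => z i - c i, h⟩ : lp (fun _ : ℕ => 𝕜) p)‖ < r}

/-- `U(ω)` for a real sequence `ω`: the pairs of radii `(r₁, r_∞)` in the closed quadrant such that
for `x, y ∈ ℓ¹` with `x - y = ω` the open `‖·‖₁`-ball of radius `r₁` around `x` and the open
`‖·‖_∞`-ball of radius `r_∞` around `y` do not intersect. -/
def seqU (𝕜 : Type*) [RCLike 𝕜] (ω : ℕ → ℝ) : Set (ℝ≥0 × ℝ≥0) :=
  {r | ∀ x y : ℕ → 𝕜, Memℓp x 1 → Memℓp y 1 → (∀ i, x i - y i = (ω i : 𝕜)) →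
    seqBall 1 x r.1 ∩ seqBall ∞ y r.2 = ∅}

end Sequences

/-! ### Operators -/

section Operators

variable {H : Type*} [NormedAddCommGroup H] [InnerProductSpace ℂ H]

/-- The sum of the diagonal entries `⟪e i, P (e i)⟫` of `P` in a Hilbert basis `e`; it is used for
positive `P` only. -/
def diagSum {ι : Type*} (e : HilbertBasis ι ℂ H) (P : H →L[ℂ] H) : ℝ≥0∞ :=
  ∑' i, ENNReal.ofReal (RCLike.re ⟪e i, P (e i)⟫_ℂ)

lemma parseval_enorm {ι : Type*} (e : HilbertBasis ι ℂ H) (x : H) :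
    ENNReal.ofReal (‖x‖ ^ 2) = ∑' i, ENNReal.ofReal (‖⟪e i, x⟫_ℂ‖ ^ 2) := by
  have h := e.hasSum_inner_mul_inner x x
  have h2 : HasSum (fun i => ‖⟪e i, x⟫_ℂ‖ ^ 2) (‖x‖ ^ 2) := by
    have h3 := (Complex.reCLM.hasSum h)
    convert h3 using 1
    · funext i
      rw [← inner_conj_symm x (e i)]
      simp only [Complex.reCLM_apply]
      rw [← Complex.normSq_eq_conj_mul_self, Complex.ofReal_re, Complex.normSq_eq_norm_sq]
    · exact (inner_self_eq_norm_sq (𝕜 := ℂ) x).symm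
  rw [← h2.tsum_eq, ENNReal.ofReal_tsum_of_nonneg (fun i => by positivity) h2.summable]

variable [CompleteSpace H]

/-- The diagonal sum of a positive operator does not depend on the Hilbert basis. -/
lemma diagSum_eq_diagSum {ι κ : Type*} (e : HilbertBasis ι ℂ H) (f : HilbertBasis κ ℂ H)
    {P : H →L[ℂ] H} (hP : P.IsPositive) : diagSum e P = diagSum f P := by
  have hP' : 0 ≤ P := P.nonneg_iff_isPositive.2 hP
  set Q := CFC.sqrt P
  have hQs : Q.IsPositive := Q.nonneg_iff_isPositive.1 (CFC.sqrt_nonneg P)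
  have hPQ : ∀ x, RCLike.re ⟪x, P x⟫_ℂ = ‖Q x‖ ^ 2 := fun x => by
    have h1 : P x = Q (Q x) := by
      have h0 : Q * Q = P := CFC.sqrt_mul_sqrt_self P hP'
      exact (congrArg (fun T : H →L[ℂ] H => T x) h0).symm
    have h2 : ⟪Q x, Q x⟫_ℂ = ⟪x, Q (Q x)⟫_ℂ := hQs.isSymmetric x (Q x)
    rw [h1, ← h2]
    exact inner_self_eq_norm_sq (𝕜 := ℂ) (Q x)
  unfold diagSum
  simp only [hPQ]
  simp_rw [parseval_enorm f (Q (e _)), parseval_enorm e (Q (f _))]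
  rw [ENNReal.tsum_comm]
  refine tsum_congr fun j => tsum_congr fun i => ?_
  have h2 : ⟪Q (f j), e i⟫_ℂ = ⟪f j, Q (e i)⟫_ℂ := hQs.isSymmetric (f j) (e i)
  rw [← h2, norm_inner_symm]

/-- The trace of a positive operator, in `[0, ∞]`, computed in some Hilbert basis. -/
def posTrace (P : H →L[ℂ] H) : ℝ≥0∞ :=
  diagSum (exists_hilbertBasis ℂ H).choose_spec.choose P

/-- The trace of a positive operator may be computed in any Hilbert basis. -/
lemma posTrace_eq_diagSum {ι : Type*} (e : HilbertBasis ι ℂ H) {P : H →L[ℂ] H}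
    (hP : P.IsPositive) : posTrace P = diagSum e P :=
  diagSum_eq_diagSum _ e hP

/-- The trace norm `‖T‖₁ = tr |T|`, where `|T| = (T* T)^(1/2)`. -/
def traceNorm (T : H →L[ℂ] H) : ℝ≥0∞ := posTrace (CFC.abs T)

/-- Trace-class operators. -/
def IsTraceClass (T : H →L[ℂ] H) : Prop := traceNorm T < ∞

/-- Density operators: trace-class positive operators with trace `1`. -/
structure IsDensityOp (ω : H →L[ℂ] H) : Prop where
  isTraceClass : IsTraceClass ω
  isPositive : ω.IsPositive
  trace_eq_one : posTrace ω = 1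

/-- The open `‖·‖₁`-ball of radius `r` around `c` in the space of trace-class operators. -/
def traceBall (c : H →L[ℂ] H) (r : ℝ≥0) : Set (H →L[ℂ] H) :=
  {z | IsTraceClass z ∧ traceNorm (z - c) < r}

/-- `U(ω)` for an operator `ω`: the pairs of radii `(r₁, r_∞)` in the closed quadrant such that
for trace-class `x, y` with `x - y = ω` the open `‖·‖₁`-ball of radius `r₁` around `x` and the open
operator norm ball of radius `r_∞` around `y` do not intersect. -/
def opU (ω : H →L[ℂ] H) : Set (ℝ≥0 × ℝ≥0) :=
  {r | ∀ x y : H →L[ℂ] H, IsTraceClass x → IsTraceClass y → x - y = ω →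
    traceBall x r.1 ∩ Metric.ball y r.2 = ∅}

/-- The indices of the nonzero real eigenvalues of `ω`, counted with multiplicity: an index is
a number `μ ≠ 0` together with one of `dim ker (ω - μ)` labels. -/
abbrev EigenIndex (ω : H →L[ℂ] H) : Type :=
  Σ μ : {μ : ℝ // μ ≠ 0},
    Fin (Module.finrank ℂ (Module.End.eigenspace (ω : H →ₗ[ℂ] H) ((μ : ℝ) : ℂ)))

/-- The family of the nonzero eigenvalues of `ω`, each repeated according to its multiplicity. -/
def eigenFamily (ω : H →L[ℂ] H) : EigenIndex ω → ℝ := fun k => k.1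

end Operators

/-! ### The explicit description -/

/-- The expression `∑ i, max 0 (ω i - s)`. -/
def excess {ι : Type*} (ω : ι → ℝ) (s : ℝ) : ℝ := ∑' i, max 0 (ω i - s)

/-- `U` is given explicitly by the family `ω` with largest member `N`. -/
structure IsExplicitlyGiven {ι : Type*} (U : Set (ℝ≥0 × ℝ≥0)) (ω : ι → ℝ) (N : ℝ≥0) :
    Prop where
  /-- The series `∑ i, max 0 (ω i - s)` converges. -/
  summable : ∀ s : ℝ≥0, Summable fun i => max 0 (ω i - s)
  /-- The explicit description of `U`; open balls of radius `0` are empty. -/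
  mem_iff : ∀ r₁ r : ℝ≥0, (r₁, r) ∈ U ↔ r₁ = 0 ∨ r = 0 ∨ (r₁ : ℝ) ≤ excess ω r
  /-- `N` is the maximum of the `ω i`. -/
  isGreatest : IsGreatest (Set.range ω) (N : ℝ)
  /-- Only finitely many `ω i` lie above any positive level. -/
  finite : ∀ ε : ℝ, 0 < ε → {i | ε ≤ ω i}.Finite
  /-- The boundary of `U` in the closed quadrant is, apart from the two rays on the axes, the graph
  of a function `F` on `[0, 1]`, the inverse of `s ↦ ∑ i, max 0 (ω i - s)` on `[0, N]`. It is
  continuous, decreasing, with `F 0 = N` and `F 1 = 0`, and if no `ω i` lies in `(a, b)` then `F` is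
  affine where it takes values in `[a, b]`, with slope `-1 / n`, where `n` is the number of
  the `ω i` above the interval. -/
  boundary : ∃ F : ℝ≥0 → ℝ≥0,
    F 0 = N ∧ F 1 = 0 ∧
    ContinuousOn F (Set.Icc 0 1) ∧ StrictAntiOn F (Set.Icc 0 1) ∧
    (∀ t s : ℝ≥0, t ≤ 1 → s ≤ N → (F t = s ↔ (t : ℝ) = excess ω s)) ∧
    frontier U = {p | p.1 ≤ 1 ∧ p.2 = F p.1} ∪ {p | p.1 = 0 ∧ N ≤ p.2} ∪
      {p | 1 ≤ p.1 ∧ p.2 = 0} ∧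
    ∀ a b : ℝ≥0, a < b → b ≤ N → (∀ i, ¬ ((a : ℝ) < ω i ∧ ω i < b)) →
      0 < {i | (b : ℝ) ≤ ω i}.ncard ∧
      ∀ t : ℝ≥0, t ≤ 1 → a ≤ F t → F t ≤ b →
        (F t : ℝ) = b - (t - excess ω b) / {i | (b : ℝ) ≤ ω i}.ncard

end EntropyNote

end

open scoped NNReal ENNReal InnerProductSpace

noncomputable section

namespace EntropyNote

/-! ### The function `s ↦ ∑ i, max 0 (ω i - s)` -/

section Excess

open Filter Topology

variable {ι : Type*} {ω : ι → ℝ}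

/-! If `z` lies in both balls, then `ω = c - a` with `a = z - x`, `c = z - y`, `‖a‖₁ < r₁` and
`‖c‖_∞ < r_∞`. The question is thus how cheaply, in the 1-norm, `ω` can be brought down to a given
sup norm. Each `ω i` above `s` must lose at least `ω i - s`, and replacing `ω i` by `min (ω i) s`
loses exactly that, so the price of level `s` is `G(s) = excess ω s`.

For operators the same computation takes place in an eigenbasis. The upper bound is again truncation
(`exists_truncation`). The lower bound compares diagonal entries and rests on `∑ |⟪e i, a (e i)⟫| ≤
‖a‖₁` (`sum_norm_inner_le_traceNorm`). The eigenbasis exists because a positive operator of finite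
trace is compact; its vectors with eigenvalue zero contribute nothing to `G`.

All other claims concern `G` alone (`isExplicitlyGiven_of_mem_iff`). It is continuous and
nonincreasing, falls strictly from `1` to `0` on `[0, N]`, and has slope `-n` wherever exactly `n`
members of the family lie above. `F` is its inverse there, and the boundary of `U` is found by
comparing `r₁` with `G(r)`. -/

lemma excess_term_le (h0 : ∀ i, 0 ≤ ω i) (s : ℝ≥0) (i : ι) : max 0 (ω i - s) ≤ ω i :=
  max_le (h0 i) (sub_le_self _ s.coe_nonneg)

lemma summable_excess (h0 : ∀ i, 0 ≤ ω i) (h1 : Summable ω) (s : ℝ≥0) :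
    Summable fun i => max 0 (ω i - s) :=
  h1.of_nonneg_of_le (fun _ => le_max_left _ _) (excess_term_le h0 s)

lemma continuous_excess (h0 : ∀ i, 0 ≤ ω i) (h1 : Summable ω) :
    Continuous fun s : ℝ≥0 => excess ω s := by
  refine continuous_tsum (fun i => by fun_prop) h1 fun i s => ?_
  rw [Real.norm_of_nonneg (le_max_left _ _)]
  exact excess_term_le h0 s i

lemma excess_nonneg (s : ℝ) : 0 ≤ excess ω s := tsum_nonneg fun _ => le_max_left _ _

lemma excess_zero (h0 : ∀ i, 0 ≤ ω i) (h1 : HasSum ω 1) : excess ω 0 = 1 := by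
  simp only [excess, sub_zero]
  simpa only [fun i => max_eq_right (h0 i)] using h1.tsum_eq

lemma excess_anti (h0 : ∀ i, 0 ≤ ω i) (h1 : Summable ω) :
    Antitone fun s : ℝ≥0 => excess ω s := fun s t hst =>
  (summable_excess h0 h1 t).tsum_le_tsum
    (fun _ => max_le_max le_rfl (sub_le_sub_left (NNReal.coe_le_coe.2 hst) _))
    (summable_excess h0 h1 s)

lemma excess_eq_zero {s : ℝ} (hs : ∀ i, ω i ≤ s) : excess ω s = 0 := by
  simp [excess, hs]

lemma excess_lt_excess (h0 : ∀ i, 0 ≤ ω i) (h1 : Summable ω) {s t : ℝ≥0} (hst : s < t) {i : ι}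
    (hi : s < ω i) : excess ω t < excess ω s := by
  refine Summable.tsum_lt_tsum (i := i)
    (fun j => max_le_max le_rfl (sub_le_sub_left (NNReal.coe_le_coe.2 hst.le) _)) ?_
    (summable_excess h0 h1 t) (summable_excess h0 h1 s)
  have := NNReal.coe_lt_coe.2 hst
  exact max_lt (lt_max_of_lt_right (by linarith)) (lt_max_of_lt_right (by linarith))

lemma finite_setOf_le (h1 : Summable ω) {ε : ℝ} (hε : 0 < ε) : {i | ε ≤ ω i}.Finite := by
  have := h1.tendsto_cofinite_zero.eventually (gt_mem_nhds hε)
  rw [Filter.eventually_cofinite] at this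
  simpa only [not_lt] using this

/-- Below the level `b` the excess is affine as long as no member of the family is passed. -/
lemma excess_eq_add (h0 : ∀ i, 0 ≤ ω i) (h1 : Summable ω) {a b s : ℝ≥0} (hab : a < b)
    (hgap : ∀ i, ¬ ((a : ℝ) < ω i ∧ ω i < b)) (has : a ≤ s) (hsb : s ≤ b) :
    excess ω s = excess ω b + {i | (b : ℝ) ≤ ω i}.ncard * ((b : ℝ) - s) := by
  have hb : (0 : ℝ) < b := NNReal.coe_pos.2 (pos_of_gt hab)
  have hfin := finite_setOf_le h1 hb
  have h2 : excess ω s - excess ω b = ∑' i, (max 0 (ω i - s) - max 0 (ω i - b)) :=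
    ((summable_excess h0 h1 s).tsum_sub (summable_excess h0 h1 b)).symm
  have has' := NNReal.coe_le_coe.2 has
  have hsb' := NNReal.coe_le_coe.2 hsb
  -- Terms with `ω i < b` vanish: by the gap such an `ω i` is at most `a`, hence at most `s`. Each
  -- of the others contributes `b - s`.
  rw [tsum_eq_sum (s := hfin.toFinset), Finset.sum_congr rfl (g := fun _ => (b : ℝ) - s),
    Finset.sum_const, ← Set.ncard_eq_toFinset_card _ hfin, nsmul_eq_mul] at h2
  · linarith
  · intro i hi
    have hi' : (b : ℝ) ≤ ω i := by simpa using hi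
    rw [max_eq_right (by linarith), max_eq_right (by linarith)]
    ring
  · intro i hi
    have hi' : ω i < b := by simpa using hi
    have : ω i ≤ a := not_lt.1 fun h => hgap i ⟨h, hi'⟩
    rw [max_eq_left (by linarith), max_eq_left (by linarith), sub_zero]

/-- The inverse of the excess function. -/
lemma exists_excess_inverse (h0 : ∀ i, 0 ≤ ω i) (h1 : HasSum ω 1) {N : ℝ≥0}
    (hN : IsGreatest (Set.range ω) (N : ℝ)) :
    ∃ F : ℝ≥0 → ℝ≥0, (∀ t ≤ 1, F t ≤ N) ∧
      ∀ t s : ℝ≥0, t ≤ 1 → s ≤ N → (F t = s ↔ (t : ℝ) = excess ω s) := by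
  obtain ⟨⟨i, hi⟩, hmax⟩ := hN
  have hle : ∀ j, ω j ≤ N := fun j => hmax ⟨j, rfl⟩
  have hex : ∀ t : ℝ≥0, ∃ s : ℝ≥0, t ≤ 1 → s ≤ N ∧ excess ω s = t := by
    intro t
    by_cases ht : t ≤ 1
    · have := intermediate_value_Icc' (zero_le (a := N))
        (continuous_excess h0 h1.summable).continuousOn
      simp only [NNReal.coe_zero, excess_zero h0 h1, excess_eq_zero hle] at this
      obtain ⟨s, hs, h⟩ := this ⟨t.coe_nonneg, by exact_mod_cast ht⟩
      exact ⟨s, fun _ => ⟨hs.2, h⟩⟩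
    -- Outside `[0, 1]` the value of `F` is irrelevant.
    · exact ⟨0, fun h => absurd h ht⟩
  choose F hF using hex
  refine ⟨F, fun t ht => (hF t ht).1, fun t s ht hs => ⟨?_, fun h => ?_⟩⟩
  · rintro rfl
    exact (hF t ht).2.symm
  · have h2 := (hF t ht).2.trans h
    -- The index attaining `N` lies strictly above every level below `N`, so the excess is injective
    -- on `[0, N]`.
    rcases lt_trichotomy (F t) s with hlt | heq | hgt
    · refine absurd h2 (excess_lt_excess h0 h1.summable hlt (i := i) ?_).ne'
      rw [hi]; exact_mod_cast hlt.trans_le hs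
    · exact heq
    · refine absurd h2 (excess_lt_excess h0 h1.summable hgt (i := i) ?_).ne
      rw [hi]; exact_mod_cast hgt.trans_le (hF t ht).1

lemma excess_eq_zero_iff (h0 : ∀ i, 0 ≤ ω i) (h1 : Summable ω) {N : ℝ≥0}
    (hN : IsGreatest (Set.range ω) (N : ℝ)) (s : ℝ≥0) : excess ω s = 0 ↔ N ≤ s := by
  obtain ⟨⟨i, hi⟩, hmax⟩ := hN
  constructor
  · intro h
    by_contra! hlt
    refine (excess_lt_excess h0 h1 hlt (i := i) ?_).not_ge (h ▸ excess_nonneg _)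
    rw [hi]; exact_mod_cast hlt
  · exact fun h => excess_eq_zero fun j => (hmax ⟨j, rfl⟩).trans (by exact_mod_cast h)

/-- `U` is closed, and its interior relative to the quadrant is the region `r₁ < G(r)`. That region
contains the axis points near the origin, which is why only rays of the axes remain in the boundary.
-/
lemma frontier_eq_of_mem_iff (h0 : ∀ i, 0 ≤ ω i) (h1 : Summable ω) {U : Set (ℝ≥0 × ℝ≥0)}
    (hU : ∀ r₁ r : ℝ≥0, (r₁, r) ∈ U ↔ r₁ = 0 ∨ r = 0 ∨ (r₁ : ℝ) ≤ excess ω r) :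
    frontier U = {p | p ∈ U ∧ excess ω p.2 ≤ p.1} := by
  have hc := continuous_excess h0 h1
  have hUeq : U = {p | p.1 = 0} ∪ ({p | p.2 = 0} ∪ {p | (p.1 : ℝ) ≤ excess ω p.2}) := by
    ext ⟨r₁, r⟩
    exact hU r₁ r
  have hclosed : IsClosed U := by
    rw [hUeq]
    exact (isClosed_eq continuous_fst continuous_const).union
      ((isClosed_eq continuous_snd continuous_const).union
        (isClosed_le (by fun_prop) (hc.comp continuous_snd)))
  have hint : interior U = {p | (p.1 : ℝ) < excess ω p.2} := by
    refine subset_antisymm (fun p hp => ?_) (interior_maximal (fun p hp => ?_) ?_)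
    · by_contra hlt
      rw [Set.mem_ofPred_eq, not_lt] at hlt
      -- Moving along the diagonal leaves both axes and raises the first coordinate, while the
      -- excess cannot grow. Hence a point with `excess ω p.2 ≤ p.1` is a limit of points outside
      -- `U`.
      have htend : Tendsto (fun ε : ℝ≥0 => (p.1 + ε, p.2 + ε)) (𝓝[>] 0) (𝓝 p) := by
        refine tendsto_nhdsWithin_of_tendsto_nhds ?_
        have : Continuous fun ε : ℝ≥0 => (p.1 + ε, p.2 + ε) := by fun_prop
        simpa using this.tendsto 0
      have hev := htend.eventually (mem_interior_iff_mem_nhds.1 hp)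
      obtain ⟨ε, hε, hpos⟩ := (hev.and self_mem_nhdsWithin).exists
      have hpos : 0 < ε := hpos
      rcases (hU _ _).1 hε with h | h | h
      · exact (add_pos_of_nonneg_of_pos (zero_le) hpos).ne' h
      · exact (add_pos_of_nonneg_of_pos (zero_le) hpos).ne' h
      · have h3 := excess_anti h0 h1 (le_self_add : p.2 ≤ p.2 + ε)
        have h4 : (0 : ℝ) < ε := hpos
        rw [NNReal.coe_add] at h
        simp only at h3
        linarith
    · exact (hU p.1 p.2).2 (Or.inr (Or.inr (le_of_lt hp)))
    · exact isOpen_lt (by fun_prop) (hc.comp continuous_snd)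
  rw [hclosed.frontier_eq, hint]
  ext p
  simp

theorem isExplicitlyGiven_of_mem_iff (h0 : ∀ i, 0 ≤ ω i) (h1 : HasSum ω 1) {N : ℝ≥0}
    (hN : IsGreatest (Set.range ω) (N : ℝ)) {U : Set (ℝ≥0 × ℝ≥0)}
    (hU : ∀ r₁ r : ℝ≥0, (r₁, r) ∈ U ↔ r₁ = 0 ∨ r = 0 ∨ (r₁ : ℝ) ≤ excess ω r) :
    IsExplicitlyGiven U ω N := by
  refine ⟨summable_excess h0 h1.summable, hU, hN, fun ε hε => finite_setOf_le h1.summable hε, ?_⟩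
  obtain ⟨F, hFN, hF⟩ := exists_excess_inverse h0 h1 hN
  have hG : ∀ t ≤ 1, excess ω (F t) = t := fun t ht => ((hF t _ ht (hFN t ht)).1 rfl).symm
  have hz := excess_eq_zero_iff h0 h1.summable hN
  have hanti := excess_anti h0 h1.summable
  have hle1 : ∀ s : ℝ≥0, excess ω s ≤ 1 := fun s => by
    simpa [excess_zero h0 h1] using hanti (zero_le (a := s))
  -- This equivalence and the next turn order conditions on `F t` into open conditions on `t`;
  -- continuity and strict monotonicity of `F` follow from them.
  have hlt : ∀ t ≤ 1, ∀ u : ℝ≥0, u < F t ↔ (t : ℝ) < excess ω u := fun t ht u => by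
    refine ⟨fun h => ?_, fun h => ?_⟩
    · rw [← hG t ht]
      refine (hanti h.le).lt_of_ne fun h2 => ?_
      exact h.ne' ((hF t u ht (h.le.trans (hFN t ht))).2 ((hG t ht).symm.trans h2))
    · by_contra! h2
      exact h.not_ge ((hanti h2).trans_eq (hG t ht))
  -- The bound `u ≤ N` matters: above `N` the excess stays zero, so `F 0 < u` holds there without
  -- `excess ω u < 0`.
  have hgt : ∀ t ≤ 1, ∀ u : ℝ≥0, u ≤ N → (F t < u ↔ excess ω u < t) := fun t ht u hu => by
    refine ⟨fun h => ?_, fun h => ?_⟩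
    · rw [← hG t ht]
      refine (hanti h.le).lt_of_ne fun h2 => ?_
      exact h.ne ((hF t u ht hu).2 ((hG t ht).symm.trans h2.symm))
    · by_contra! h2
      exact h.not_ge ((hG t ht).symm.trans_le (hanti h2))
  refine ⟨F, ?_, ?_, ?_, ?_, hF, ?_, ?_⟩
  · exact (hF 0 N zero_le_one le_rfl).2 (by simpa using ((hz N).2 le_rfl).symm)
  · exact (hF 1 0 le_rfl zero_le).2 (by simpa using (excess_zero h0 h1).symm)
  · intro t₀ ht₀
    refine tendsto_order.2 ⟨fun u hu => ?_, fun u hu => ?_⟩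
    · have h2 : ∀ᶠ t : ℝ≥0 in 𝓝 t₀, (t : ℝ) < excess ω u :=
        (isOpen_lt NNReal.continuous_coe continuous_const).mem_nhds ((hlt _ ht₀.2 u).1 hu)
      filter_upwards [mem_nhdsWithin_of_mem_nhds h2, self_mem_nhdsWithin] with t h3 h4
      exact (hlt t h4.2 u).2 h3
    · rcases le_or_gt u N with huN | huN
      · have h2 : ∀ᶠ t : ℝ≥0 in 𝓝 t₀, excess ω u < (t : ℝ) :=
          (isOpen_lt continuous_const NNReal.continuous_coe).mem_nhds ((hgt _ ht₀.2 u huN).1 hu)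
        filter_upwards [mem_nhdsWithin_of_mem_nhds h2, self_mem_nhdsWithin] with t h3 h4
        exact (hgt t h4.2 u huN).2 h3
      · filter_upwards [self_mem_nhdsWithin] with t h4
        exact (hFN t h4.2).trans_lt huN
  · intro t ht t' ht' htt
    rw [hlt t ht.2, hG t' ht'.2]
    exact_mod_cast htt
  · rw [frontier_eq_of_mem_iff h0 h1.summable hU]
    ext ⟨t, s⟩
    simp only [Set.mem_ofPred_eq, Set.mem_union, hU]
    constructor
    · rintro ⟨h | h | h, h2⟩
      · left; right
        refine ⟨h, (hz s).1 (le_antisymm ?_ (excess_nonneg _))⟩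
        simpa [h] using h2
      · right
        refine ⟨?_, h⟩
        rw [h, NNReal.coe_zero, excess_zero h0 h1] at h2
        exact_mod_cast h2
      · have h3 := le_antisymm h h2
        rcases le_total s N with hs | hs
        · have ht : t ≤ 1 := by exact_mod_cast h.trans (hle1 s)
          exact Or.inl (Or.inl ⟨ht, ((hF t s ht hs).2 h3).symm⟩)
        · rw [(hz s).2 hs] at h3
          exact Or.inl (Or.inr ⟨by exact_mod_cast h3, hs⟩)
    · rintro ((⟨ht, rfl⟩ | ⟨rfl, hs⟩) | ⟨ht, rfl⟩)
      · exact ⟨Or.inr (Or.inr (hG t ht).ge), (hG t ht).le⟩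
      · exact ⟨Or.inl rfl, by simp [(hz s).2 hs]⟩
      · refine ⟨Or.inr (Or.inl rfl), ?_⟩
        rw [NNReal.coe_zero, excess_zero h0 h1]
        exact_mod_cast ht
  · intro a b hab hbN hgap
    have hb : (0 : ℝ) < b := NNReal.coe_pos.2 (pos_of_gt hab)
    have hpos : 0 < {i | (b : ℝ) ≤ ω i}.ncard := by
      rw [Set.ncard_pos (finite_setOf_le h1.summable hb)]
      obtain ⟨i, hi⟩ := hN.1
      exact ⟨i, by rw [Set.mem_ofPred_eq, hi]; exact_mod_cast hbN⟩
    refine ⟨hpos, fun t ht ha hb' => ?_⟩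
    have h2 := excess_eq_add h0 h1.summable hab hgap ha hb'
    rw [hG t ht] at h2
    rw [h2]
    have : ({i | (b : ℝ) ≤ ω i}.ncard : ℝ) ≠ 0 := by exact_mod_cast hpos.ne'
    field_simp
    ring

/-- A nonnegative family with sum `1` attains its supremum, at a positive member. -/
lemma exists_isGreatest_range (h0 : ∀ i, 0 ≤ ω i) (h1 : HasSum ω 1) :
    ∃ i, 0 < ω i ∧ ∀ j, ω j ≤ ω i := by
  obtain ⟨k, hk⟩ : ∃ k, 0 < ω k := by
    by_contra! h
    have : ω = 0 := funext fun i => le_antisymm (h i) (h0 i)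
    rw [this] at h1
    exact zero_ne_one (hasSum_zero.unique h1)
  obtain ⟨i, hi, hmax⟩ := Set.exists_max_image _ ω (finite_setOf_le h1.summable hk)
    ⟨k, le_refl (ω k)⟩
  refine ⟨i, hk.trans_le hi, fun j => ?_⟩
  rcases le_total (ω k) (ω j) with h | h
  · exact hmax j h
  · exact h.trans hi

/-- Radii slightly below `r` still have small excess. -/
lemma exists_lt_excess_lt (h0 : ∀ i, 0 ≤ ω i) (h1 : Summable ω) {r : ℝ≥0} {c : ℝ} (hr : 0 < r)
    (hc : excess ω r < c) : ∃ s : ℝ≥0, 0 < s ∧ s < r ∧ excess ω s < c := by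
  have h2 : ∀ᶠ s : ℝ≥0 in 𝓝[<] r, excess ω s < c :=
    mem_nhdsWithin_of_mem_nhds
      ((isOpen_lt (continuous_excess h0 h1) continuous_const).mem_nhds hc)
  have : (𝓝[<] r).NeBot := nhdsLT_neBot_of_exists_lt ⟨0, hr⟩
  obtain ⟨s, hs, hs'⟩ := (h2.and (Ioo_mem_nhdsLT hr)).exists
  exact ⟨s, hs'.1, hs'.2, hs⟩

end Excess

/-! ### Balls in the sequence spaces -/

section SequenceBalls

variable {𝕜 : Type*} [RCLike 𝕜]

lemma mem_seqBall_one {c z : ℕ → 𝕜} {r : ℝ≥0} :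
    z ∈ seqBall 1 c r ↔ Summable (fun i => ‖z i - c i‖) ∧ ∑' i, ‖z i - c i‖ < r := by
  have h1 : (0 : ℝ) < (1 : ℝ≥0∞).toReal := by simp
  simp [seqBall, memℓp_gen_iff h1, lp.norm_eq_tsum_rpow h1]

lemma norm_sub_lt_of_mem_seqBall_top {c z : ℕ → 𝕜} {r : ℝ≥0} (h : z ∈ seqBall ∞ c r) (i : ℕ) :
    ‖z i - c i‖ < r := by
  obtain ⟨h1, h2⟩ := h
  exact (lp.norm_apply_le_norm ENNReal.top_ne_zero
    (⟨_, h1⟩ : lp (fun _ : ℕ => 𝕜) ∞) i).trans_lt h2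

lemma mem_seqBall_top {c z : ℕ → 𝕜} {s r : ℝ≥0} (h : ∀ i, ‖z i - c i‖ ≤ s) (hs : s < r) :
    z ∈ seqBall ∞ c r :=
  ⟨memℓp_infty ⟨s, by rintro _ ⟨i, rfl⟩; exact h i⟩,
    (lp.norm_le_of_forall_le s.coe_nonneg h).trans_lt (by exact_mod_cast hs)⟩

lemma IsProbSeq.mem_seqU_iff {ω : ℕ → ℝ} (hω : IsProbSeq ω) (r₁ r : ℝ≥0) :
    (r₁, r) ∈ seqU 𝕜 ω ↔ r₁ = 0 ∨ r = 0 ∨ (r₁ : ℝ) ≤ excess ω r := by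
  have hsum := hω.hasSum_one.summable
  constructor
  · intro hU
    by_contra! h
    obtain ⟨hr₁, hr, hex⟩ := h
    -- Truncation at `r` itself could have sup norm equal to `r`, outside the open ball. A level
    -- slightly below `r` still costs less than `r₁`.
    obtain ⟨s, -, hsr, hs⟩ := exists_lt_excess_lt hω.nonneg hsum (pos_iff_ne_zero.2 hr) hex
    have hx : Memℓp (fun i => (ω i : 𝕜)) 1 := by
      refine memℓp_gen ?_
      simpa [abs_of_nonneg (hω.nonneg _)] using hsum
    have hdis := hU (fun i => (ω i : 𝕜)) 0 hx zero_memℓp (fun i => by simp)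
    refine Set.eq_empty_iff_forall_notMem.1 hdis (fun i => ((min (ω i) s : ℝ) : 𝕜)) ⟨?_, ?_⟩
    · have : ∀ i, ‖((min (ω i) s : ℝ) : 𝕜) - (ω i : 𝕜)‖ = max 0 (ω i - s) := fun i => by
        rw [← RCLike.ofReal_sub, RCLike.norm_ofReal, abs_sub_comm]
        rcases le_total (ω i) s with h | h
        · simp [h]
        · simp [h]
      rw [mem_seqBall_one]
      simp only [this]
      exact ⟨summable_excess hω.nonneg hsum s, hs⟩
    · refine mem_seqBall_top (fun i => ?_) hsr
      rw [Pi.zero_apply, sub_zero, RCLike.norm_ofReal,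
        abs_of_nonneg (le_min (hω.nonneg i) s.coe_nonneg)]
      exact min_le_right _ _
  · intro h x y _ _ hxy
    refine Set.eq_empty_iff_forall_notMem.2 fun z hz => ?_
    obtain ⟨hz1, hz2⟩ := hz
    rw [mem_seqBall_one] at hz1
    have hr := norm_sub_lt_of_mem_seqBall_top hz2
    rcases h with rfl | rfl | h
    · exact hz1.2.not_ge (tsum_nonneg fun _ => norm_nonneg _)
    · exact (hr 0).not_ge (norm_nonneg _)
    · refine hz1.2.not_ge (h.trans ?_)
      refine (summable_excess hω.nonneg hsum r).tsum_le_tsum (fun i => ?_) hz1.1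
      refine max_le (norm_nonneg _) ?_
      have h2 : ω i = ‖(z i - y i) - (z i - x i)‖ := by
        rw [sub_sub_sub_cancel_left, hxy, RCLike.norm_ofReal, abs_of_nonneg (hω.nonneg i)]
      have h3 := norm_sub_le (z i - y i) (z i - x i)
      have h4 := hr i
      simp only at h4
      linarith

theorem IsProbSeq.isExplicitlyGiven {ω : ℕ → ℝ} (hω : IsProbSeq ω) :
    ∃ h : Memℓp ω ∞,
      IsExplicitlyGiven (seqU 𝕜 ω) ω ‖(⟨ω, h⟩ : lp (fun _ : ℕ => ℝ) ∞)‖₊ := by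
  obtain ⟨i, -, hi⟩ := exists_isGreatest_range hω.nonneg hω.hasSum_one
  have hle : ∀ j, ‖ω j‖ ≤ ω i := fun j => by
    rw [Real.norm_of_nonneg (hω.nonneg j)]
    exact hi j
  have h : Memℓp ω ∞ := memℓp_infty ⟨ω i, by rintro _ ⟨j, rfl⟩; exact hle j⟩
  refine ⟨h, isExplicitlyGiven_of_mem_iff hω.nonneg hω.hasSum_one ?_ hω.mem_seqU_iff⟩
  have hnorm : ‖(⟨ω, h⟩ : lp (fun _ : ℕ => ℝ) ∞)‖ = ω i :=
    le_antisymm (lp.norm_le_of_forall_le (hω.nonneg i) hle) <|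
      (le_abs_self _).trans
        (lp.norm_apply_le_norm ENNReal.top_ne_zero (⟨ω, h⟩ : lp (fun _ : ℕ => ℝ) ∞) i)
  rw [coe_nnnorm, hnorm]
  exact ⟨⟨i, rfl⟩, by rintro _ ⟨j, rfl⟩; exact hi j⟩

end SequenceBalls

/-! ### Positive operators of finite trace are compact -/

section Compactness

open Filter Topology

variable {H : Type*} [NormedAddCommGroup H] [InnerProductSpace ℂ H]

lemma hasSum_norm_inner_sq {ι : Type*} (e : HilbertBasis ι ℂ H) (x : H) :
    HasSum (fun i => ‖⟪e i, x⟫_ℂ‖ ^ 2) (‖x‖ ^ 2) := by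
  convert! Complex.reCLM.hasSum (e.hasSum_inner_mul_inner x x) using 1
  · funext i
    rw [← inner_conj_symm x (e i)]
    simp only [Complex.reCLM_apply]
    rw [← Complex.normSq_eq_conj_mul_self, Complex.ofReal_re, Complex.normSq_eq_norm_sq]
  · exact (inner_self_eq_norm_sq (𝕜 := ℂ) x).symm

variable [CompleteSpace H]

lemma isPositive_sqrt (P : H →L[ℂ] H) : (CFC.sqrt P).IsPositive :=
  (CFC.sqrt P).nonneg_iff_isPositive.1 (CFC.sqrt_nonneg P)

lemma sqrt_apply_sqrt_apply {P : H →L[ℂ] H} (hP : P.IsPositive) (x : H) :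
    CFC.sqrt P (CFC.sqrt P x) = P x :=
  congrArg (fun T : H →L[ℂ] H => T x)
    (CFC.sqrt_mul_sqrt_self P (P.nonneg_iff_isPositive.2 hP))

lemma re_inner_apply_eq_norm_sqrt_sq {P : H →L[ℂ] H} (hP : P.IsPositive) (x : H) :
    RCLike.re ⟪x, P x⟫_ℂ = ‖CFC.sqrt P x‖ ^ 2 := by
  rw [← sqrt_apply_sqrt_apply hP, ← (isPositive_sqrt P).inner_left_eq_inner_right]
  exact inner_self_eq_norm_sq (𝕜 := ℂ) _

lemma hasSum_re_inner_posTrace {ι : Type*} (e : HilbertBasis ι ℂ H) {P : H →L[ℂ] H}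
    (hP : P.IsPositive) (h : posTrace P ≠ ∞) :
    HasSum (fun i => RCLike.re ⟪e i, P (e i)⟫_ℂ) (posTrace P).toReal := by
  rw [posTrace_eq_diagSum e hP, diagSum] at h ⊢
  have h2 := ENNReal.hasSum_toReal h
  rw [← ENNReal.tsum_toReal_eq (fun i => ENNReal.ofReal_ne_top)] at h2
  simpa only [ENNReal.toReal_ofReal (hP.re_inner_nonneg_right _)] using h2

lemma hasSum_norm_sqrt_sq {ι : Type*} (e : HilbertBasis ι ℂ H) {P : H →L[ℂ] H}
    (hP : P.IsPositive) (h : posTrace P ≠ ∞) :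
    HasSum (fun i => ‖CFC.sqrt P (e i)‖ ^ 2) (posTrace P).toReal := by
  simpa only [re_inner_apply_eq_norm_sqrt_sq hP] using hasSum_re_inner_posTrace e hP h

/-- A self-adjoint Hilbert–Schmidt operator is compact. -/
lemma isCompactOperator_of_summable_norm_sq {ι : Type*} (e : HilbertBasis ι ℂ H) {Q : H →L[ℂ] H}
    (hQ : (Q : H →ₗ[ℂ] H).IsSymmetric) (h : Summable fun i => ‖Q (e i)‖ ^ 2) :
    IsCompactOperator Q := by
  classical
  set R : Finset ι → H →L[ℂ] H := fun F => ∑ i ∈ F, (InnerProductSpace.rankOne ℂ (e i) (e i)) ∘L Q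
  have hR : ∀ F x, R F x = ∑ i ∈ F, ⟪e i, Q x⟫_ℂ • e i := fun F x => by simp [R]
  have hcoef : ∀ F x j, ⟪e j, Q x - R F x⟫_ℂ = if j ∈ F then 0 else ⟪e j, Q x⟫_ℂ := fun F x j => by
    rw [inner_sub_right, hR]
    split_ifs with hj
    · rw [e.orthonormal.inner_right_sum _ hj, sub_self]
    · rw [inner_sum, Finset.sum_eq_zero, sub_zero]
      intro i hi
      have hji : j ≠ i := fun h => hj (h ▸ hi)
      rw [inner_smul_right, e.orthonormal.2 hji, mul_zero]
  -- Parseval leaves the coefficients `⟪e i, Q x⟫ = ⟪Q (e i), x⟫` with `i ∉ F`, each bounded by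
  -- Cauchy–Schwarz. So the finite-rank operators `R F` converge to `Q` in norm.
  have hbound : ∀ F, ‖Q - R F‖ ≤ √(∑' i : {i // i ∉ F}, ‖Q (e i)‖ ^ 2) := fun F => by
    refine ContinuousLinearMap.opNorm_le_bound _ (Real.sqrt_nonneg _) fun x => ?_
    refine le_of_sq_le_sq ?_ (by positivity)
    rw [mul_pow, Real.sq_sqrt (tsum_nonneg fun _ => by positivity)]
    have h1 := hasSum_norm_inner_sq e ((Q - R F) x)
    have h2 : HasSum (fun i => if i ∈ F then (0 : ℝ) else ‖Q (e i)‖ ^ 2)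
        (∑' i : {i // i ∉ F}, ‖Q (e i)‖ ^ 2) := by
      have h3 := (hasSum_subtype_iff_indicator (s := {i | i ∉ F})).1
        (h.subtype {i | i ∉ F}).hasSum
      convert! h3 using 1
      funext i
      by_cases hi : i ∈ F <;> simp [hi]
    refine hasSum_le (fun i => ?_) h1 (h2.mul_right (‖x‖ ^ 2))
    rw [sub_apply, hcoef]
    split_ifs with hi
    · simp
    · rw [← mul_pow]
      have h4 : ⟪Q (e i), x⟫_ℂ = ⟪e i, Q x⟫_ℂ := hQ (e i) x
      rw [← h4]
      gcongr
      exact norm_inner_le_norm _ _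
  have htend : Tendsto R atTop (𝓝 Q) := by
    rw [tendsto_iff_norm_sub_tendsto_zero]
    refine squeeze_zero (fun _ => norm_nonneg _)
      (fun F => (norm_sub_rev _ _).trans_le (hbound F)) ?_
    have := (Real.continuous_sqrt.tendsto 0).comp
      (tendsto_tsum_compl_atTop_zero fun i => ‖Q (e i)‖ ^ 2)
    rwa [Real.sqrt_zero] at this
  refine isCompactOperator_of_tendsto htend (Eventually.of_forall fun F => ?_)
  refine Submodule.sum_mem (compactOperator (RingHom.id ℂ) H H) fun i _ => ?_
  change IsCompactOperator _
  have h5 : IsCompactOperator (innerSL ℂ (e i) : H →L[ℂ] ℂ) :=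
    isCompactOperator_of_locallyCompactSpace_dom (innerSL ℂ (e i))
  exact (h5.clm_comp (ContinuousLinearMap.toSpanSingleton ℂ (e i))).comp_clm Q

/-- The square root of `P` is Hilbert–Schmidt, since `∑ ‖√P (e i)‖²` is the trace of `P`; hence it
is compact, and so is its square. -/
lemma isCompactOperator_of_posTrace_ne_top {P : H →L[ℂ] H} (hP : P.IsPositive)
    (h : posTrace P ≠ ∞) : IsCompactOperator P := by
  obtain ⟨w, e, -⟩ := exists_hilbertBasis ℂ H
  have h1 := isCompactOperator_of_summable_norm_sq e (isPositive_sqrt P).isSymmetric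
    (hasSum_norm_sqrt_sq e hP h).summable
  have h2 : P = CFC.sqrt P ∘L CFC.sqrt P :=
    ContinuousLinearMap.ext fun x => (sqrt_apply_sqrt_apply hP x).symm
  rw [h2]
  exact h1.comp_clm _

end Compactness

/-! ### Spectral theorem with multiplicities -/

section Eigenbasis

open Module.End

variable {H : Type*} [NormedAddCommGroup H] [InnerProductSpace ℂ H]

/-- Orthonormal eigenvectors, one for each index in the list of the nonzero eigenvalues. -/
lemma exists_orthonormal_eigenFamily [CompleteSpace H] {ω : H →L[ℂ] H} (hω : (ω : H →ₗ[ℂ] H).IsSymmetric)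
    (hc : IsCompactOperator ω) :
    ∃ v : EigenIndex ω → H, Orthonormal ℂ v ∧
      (∀ k, ω (v k) = (eigenFamily ω k : ℂ) • v k) ∧
      ∀ μ : ℝ, μ ≠ 0 → eigenspace (ω : H →ₗ[ℂ] H) (μ : ℂ) ≤ Submodule.span ℂ (Set.range v) := by
  have hfd : ∀ μ : {μ : ℝ // μ ≠ 0},
      FiniteDimensional ℂ (eigenspace (ω : H →ₗ[ℂ] H) ((μ : ℝ) : ℂ)) := fun μ =>
    ContinuousLinearMap.finite_dimensional_eigenspace hc _ (Complex.ofReal_ne_zero.2 μ.2)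
  let B : ∀ μ : {μ : ℝ // μ ≠ 0}, OrthonormalBasis _ ℂ
    (eigenspace (ω : H →ₗ[ℂ] H) ((μ : ℝ) : ℂ)) := fun μ => stdOrthonormalBasis ℂ _
  have hfam := (hω.orthogonalFamily_eigenspaces).comp
    (Complex.ofReal_injective.comp Subtype.val_injective :
      Function.Injective fun μ : {μ : ℝ // μ ≠ 0} => ((μ : ℝ) : ℂ))
  refine ⟨fun k => (B k.1 k.2 : H),
    hfam.orthonormal_sigma_orthonormal fun μ => (B μ).orthonormal, fun k => ?_, fun μ hμ x hx => ?_⟩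
  · exact mem_eigenspace_iff.1 (B k.1 k.2).2
  · have h1 := congrArg Subtype.val ((B ⟨μ, hμ⟩).sum_repr ⟨x, hx⟩)
    rw [← show _ = x from h1, Submodule.coe_sum]
    refine Submodule.sum_mem _ fun i _ => ?_
    exact Submodule.smul_mem _ _ (Submodule.subset_span ⟨⟨⟨μ, hμ⟩, i⟩, rfl⟩)

/-- A compact symmetric operator kills the vectors orthogonal to all its eigenvectors for nonzero
eigenvalues. -/
lemma apply_eq_zero_of_orthogonal [CompleteSpace H] {ω : H →L[ℂ] H}
    (hω : (ω : H →ₗ[ℂ] H).IsSymmetric) (hc : IsCompactOperator ω) {x : H}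
    (hx : ∀ μ : ℝ, μ ≠ 0 → ∀ y ∈ eigenspace (ω : H →ₗ[ℂ] H) (μ : ℂ), ⟪y, x⟫_ℂ = 0) :
    ω x = 0 := by
  have h : ω x ∈ (⨆ μ, eigenspace (ω : H →ₗ[ℂ] H) μ)ᗮ := by
    rw [← Submodule.iInf_orthogonal, Submodule.mem_iInf]
    intro μ y hy
    have hy' : ω y = μ • y := mem_eigenspace_iff.1 hy
    have h1 : ⟪ω y, x⟫_ℂ = ⟪y, ω x⟫_ℂ := hω y x
    rw [← h1, hy', inner_smul_left]
    -- For `μ = 0` the scalar factor vanishes; a real `μ ≠ 0` is covered by `hx`; any other `μ` is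
    -- no eigenvalue, by symmetry.
    by_cases hμ : μ = 0
    · simp [hμ]
    by_cases hev : HasEigenvalue (ω : H →ₗ[ℂ] H) μ
    · have h2 := Complex.conj_eq_iff_real.1 (hω.conj_eigenvalue_eq_self hev)
      obtain ⟨m, rfl⟩ := h2
      rw [hx m (by simpa using hμ) y hy, mul_zero]
    · rw [hasEigenvalue_iff, not_not] at hev
      rw [hev, Submodule.mem_bot] at hy
      simp [hy]
  rw [ContinuousLinearMap.orthogonalComplement_iSup_eigenspaces_eq_bot hc hω] at h
  exact (Submodule.mem_bot ℂ).1 h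

/-- The spectral theorem for compact symmetric operators, with the nonzero eigenvalues listed by
`eigenFamily`. -/
lemma exists_eigenbasis [CompleteSpace H] {ω : H →L[ℂ] H}
    (hω : (ω : H →ₗ[ℂ] H).IsSymmetric) (hc : IsCompactOperator ω) :
    ∃ (u : Set H) (b : HilbertBasis u ℂ H) (f : EigenIndex ω → u) (l : u → ℝ),
      Function.Injective f ∧ (∀ k, l (f k) = eigenFamily ω k) ∧ (∀ i ∉ Set.range f, l i = 0) ∧
      ∀ i, ω (b i) = (l i : ℂ) • b i := by
  classical
  obtain ⟨v, hv, hωv, hspan⟩ := exists_orthonormal_eigenFamily hω hc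
  obtain ⟨u, b, hu, hb⟩ := hv.toSubtypeRange.exists_hilbertBasis_extension
  let f : EigenIndex ω → u := fun k => ⟨v k, hu ⟨k, rfl⟩⟩
  have hf : Function.Injective f := fun k k' h =>
    hv.linearIndependent.injective (congrArg Subtype.val h)
  -- Basis vectors added to complete the eigenvectors get eigenvalue `0`: they are orthogonal to all
  -- eigenspaces for nonzero real `μ`, so `ω` kills them.
  refine ⟨u, b, f, Function.extend f (eigenFamily ω) 0, hf, fun k => hf.extend_apply _ _ k,
    fun i hi => Function.extend_apply' _ _ _ hi, fun i => ?_⟩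
  by_cases hi : i ∈ Set.range f
  · obtain ⟨k, rfl⟩ := hi
    rw [hf.extend_apply, hb]
    exact hωv k
  · rw [Function.extend_apply' _ _ _ hi, Pi.zero_apply, Complex.ofReal_zero, zero_smul]
    refine apply_eq_zero_of_orthogonal hω hc fun μ hμ y hy => ?_
    refine (Submodule.mem_orthogonal (Submodule.span ℂ (Set.range v)) (b i)).1 ?_ y (hspan μ hμ hy)
    rw [Submodule.mem_orthogonal]
    intro z hz
    induction hz using Submodule.span_induction with
    | mem z hz =>
      obtain ⟨k, rfl⟩ := hz
      have : v k = b (f k) := by rw [hb]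
      rw [this]
      exact b.orthonormal.2 fun h => hi ⟨k, h⟩
    | zero => exact inner_zero_left _
    | add z z' _ _ h h' => rw [inner_add_left, h, h', add_zero]
    | smul c z _ h => rw [inner_smul_left, h, mul_zero]

end Eigenbasis

/-! ### Operators diagonal in a Hilbert basis -/

section DiagonalOperators

variable {H : Type*} [NormedAddCommGroup H] [InnerProductSpace ℂ H]

lemma inner_apply_of_diagonal {ι : Type*} (b : HilbertBasis ι ℂ H) {T : H →L[ℂ] H}
    (hT : (T : H →ₗ[ℂ] H).IsSymmetric) {l : ι → ℝ} (hl : ∀ i, T (b i) = (l i : ℂ) • b i)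
    (i : ι) (x : H) : ⟪b i, T x⟫_ℂ = l i * ⟪b i, x⟫_ℂ := by
  have h : ⟪T (b i), x⟫_ℂ = ⟪b i, T x⟫_ℂ := hT (b i) x
  rw [← h, hl, inner_smul_left, Complex.conj_ofReal]

lemma re_inner_self_of_diagonal {ι : Type*} (b : HilbertBasis ι ℂ H) {T : H →L[ℂ] H} {l : ι → ℝ}
    (hl : ∀ i, T (b i) = (l i : ℂ) • b i) (i : ι) : RCLike.re ⟪b i, T (b i)⟫_ℂ = l i := by
  rw [hl, inner_smul_right, inner_self_eq_norm_sq_to_K, b.orthonormal.1 i]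
  simp

lemma norm_le_of_diagonal {ι : Type*} (b : HilbertBasis ι ℂ H) {T : H →L[ℂ] H}
    (hT : (T : H →ₗ[ℂ] H).IsSymmetric) {l : ι → ℝ} (hl : ∀ i, T (b i) = (l i : ℂ) • b i)
    {C : ℝ} (hC : 0 ≤ C) (hlC : ∀ i, |l i| ≤ C) : ‖T‖ ≤ C := by
  refine ContinuousLinearMap.opNorm_le_bound _ hC fun x => le_of_sq_le_sq ?_ (by positivity)
  rw [mul_pow]
  refine hasSum_le (fun i => ?_) (hasSum_norm_inner_sq b (T x))
    ((hasSum_norm_inner_sq b x).mul_left (C ^ 2))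
  rw [inner_apply_of_diagonal b hT hl, norm_mul, mul_pow, Complex.norm_real]
  gcongr
  exact hlC i

lemma isPositive_of_diagonal {ι : Type*} (b : HilbertBasis ι ℂ H) {T : H →L[ℂ] H}
    (hT : (T : H →ₗ[ℂ] H).IsSymmetric) {l : ι → ℝ} (hl : ∀ i, T (b i) = (l i : ℂ) • b i)
    (h0 : ∀ i, 0 ≤ l i) : T.IsPositive := by
  refine ContinuousLinearMap.isPositive_def.2 ⟨hT, fun x => ?_⟩
  have h : ⟪T x, x⟫_ℂ = ⟪x, T x⟫_ℂ := hT x x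
  rw [ContinuousLinearMap.reApplyInnerSelf, h]
  refine (Complex.reCLM.hasSum (b.hasSum_inner_mul_inner x (T x))).nonneg fun i => ?_
  rw [inner_apply_of_diagonal b hT hl, ← inner_conj_symm x (b i), mul_left_comm,
    ← Complex.normSq_eq_conj_mul_self, ← Complex.ofReal_mul]
  exact mul_nonneg (h0 i) (Complex.normSq_nonneg _)

lemma traceNorm_of_isPositive [CompleteSpace H] {T : H →L[ℂ] H} (hT : T.IsPositive) :
    traceNorm T = posTrace T := by
  rw [traceNorm, CFC.abs_of_nonneg T (T.nonneg_iff_isPositive.2 hT)]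

lemma posTrace_of_diagonal [CompleteSpace H] {ι : Type*} (b : HilbertBasis ι ℂ H) {T : H →L[ℂ] H}
    (hT : T.IsPositive) {l : ι → ℝ} (hl : ∀ i, T (b i) = (l i : ℂ) • b i) :
    posTrace T = ∑' i, ENNReal.ofReal (l i) := by
  rw [posTrace_eq_diagSum b hT, diagSum]
  simp only [re_inner_self_of_diagonal b hl]

end DiagonalOperators

/-! ### Diagonal entries and the trace norm -/

section TraceNorm

variable {H : Type*} [NormedAddCommGroup H] [InnerProductSpace ℂ H] [CompleteSpace H]

lemma isPositive_abs (u : H →L[ℂ] H) : (CFC.abs u).IsPositive :=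
  (CFC.abs u).nonneg_iff_isPositive.1 (CFC.abs_nonneg u)

/-- Both squared norms equal `⟪x, u* u x⟫`, because `|u|² = u* u`. -/
lemma norm_abs_apply (u : H →L[ℂ] H) (x : H) : ‖CFC.abs u x‖ = ‖u x‖ := by
  have h1 : CFC.abs u (CFC.abs u x) = ContinuousLinearMap.adjoint u (u x) :=
    congrArg (fun T : H →L[ℂ] H => T x) (CFC.abs_mul_abs u)
  have h2 : ⟪CFC.abs u x, CFC.abs u x⟫_ℂ = ⟪u x, u x⟫_ℂ := by
    rw [(isPositive_abs u).inner_left_eq_inner_right, h1, ContinuousLinearMap.adjoint_inner_right]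
  rw [← sq_eq_sq₀ (norm_nonneg _) (norm_nonneg _), ← inner_self_eq_norm_sq (𝕜 := ℂ),
    ← inner_self_eq_norm_sq (𝕜 := ℂ), h2]

/-- An approximate polar decomposition. -/
lemma exists_contraction_norm_sub_comp_abs_le (u : H →L[ℂ] H) {ε : ℝ} (hε : 0 < ε) :
    ∃ W : H →L[ℂ] H, ‖W‖ ≤ 1 ∧ ‖u - W ∘L CFC.abs u‖ ≤ ε := by
  set P := CFC.abs u
  -- The contraction is `W = u (|u| + ε)⁻¹`. It satisfies `‖W‖ ≤ 1` because `‖u y‖ = ‖|u| y‖ ≤ ‖(|u|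
  -- + ε) y‖`, and the error `u - W |u|` is `ε W`.
  have hunit : IsUnit (P + algebraMap ℝ (H →L[ℂ] H) ε) := by
    have h1 : -ε ∉ spectrum ℝ P := fun h =>
      (spectrum_nonneg_of_nonneg (CFC.abs_nonneg u) h).not_gt (neg_lt_zero.2 hε)
    rw [spectrum.notMem_iff] at h1
    convert! h1.neg using 1
    rw [map_neg]
    abel
  obtain ⟨⟨V, R, hVR, hRV⟩, hV⟩ := hunit
  simp only at hV
  have hVapp : ∀ y, V y = P y + (ε : ℂ) • y := fun y => by
    rw [hV, Algebra.algebraMap_eq_smul_one]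
    simp
  have hW : ‖u ∘L R‖ ≤ 1 := by
    refine ContinuousLinearMap.opNorm_le_bound _ zero_le_one fun x => ?_
    have hx : V (R x) = x := congrArg (fun T : H →L[ℂ] H => T x) hVR
    rw [one_mul, ContinuousLinearMap.comp_apply, ← norm_abs_apply]
    nth_rw 2 [← hx]
    rw [hVapp]
    refine le_of_sq_le_sq ?_ (norm_nonneg _)
    rw [norm_add_sq (𝕜 := ℂ), inner_smul_right]
    have h2 := (isPositive_abs u).re_inner_nonneg_left (R x)
    have h3 : RCLike.re ((ε : ℂ) * ⟪P (R x), R x⟫_ℂ) = ε * RCLike.re ⟪P (R x), R x⟫_ℂ := by simp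
    rw [h3]
    have := mul_nonneg hε.le h2
    have := sq_nonneg ‖(ε : ℂ) • R x‖
    linarith
  refine ⟨u ∘L R, hW, ?_⟩
  have h4 : u - (u ∘L R) ∘L P = (ε : ℂ) • (u ∘L R) := by
    ext x
    have hx : R (V x) = x := congrArg (fun T : H →L[ℂ] H => T x) hRV
    rw [hVapp, map_add, map_smul] at hx
    simp only [sub_apply, ContinuousLinearMap.comp_apply, smul_apply]
    nth_rw 1 [← hx]
    rw [map_add, map_smul, add_sub_cancel_left]
  rw [h4, norm_smul, Complex.norm_real, Real.norm_of_nonneg hε.le]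
  exact mul_le_of_le_one_right hε.le hW

/-- Expand each norm in a Hilbert basis `b` and exchange the sums. Bessel's inequality for `e`
bounds the `j`-th inner sum by `‖W* √P (b j)‖² ≤ ‖√P (b j)‖²`, and these add up to the trace. -/
lemma sum_norm_sqrt_comp_sq_le {P : H →L[ℂ] H} (hP : P.IsPositive) (h : posTrace P ≠ ∞)
    {W : H →L[ℂ] H} (hW : ‖W‖ ≤ 1) {ι : Type*} {e : ι → H} (he : Orthonormal ℂ e) (F : Finset ι) :
    ∑ i ∈ F, ‖CFC.sqrt P (W (e i))‖ ^ 2 ≤ (posTrace P).toReal := by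
  obtain ⟨w, b, -⟩ := exists_hilbertBasis ℂ H
  set Q := CFC.sqrt P
  refine hasSum_le (fun j => ?_) (hasSum_sum fun i _ => hasSum_norm_inner_sq b (Q (W (e i))))
    (hasSum_norm_sqrt_sq b hP h)
  have h1 : ∀ i, ‖⟪b j, Q (W (e i))⟫_ℂ‖ = ‖⟪e i, ContinuousLinearMap.adjoint W (Q (b j))⟫_ℂ‖ :=
    fun i => by
      rw [← (isPositive_sqrt P).inner_left_eq_inner_right, ContinuousLinearMap.adjoint_inner_right,
        norm_inner_symm]
  simp only [h1]
  refine (he.sum_inner_products_le _).trans ?_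
  gcongr
  refine (ContinuousLinearMap.le_opNorm _ _).trans ?_
  rw [LinearIsometryEquiv.norm_map]
  exact mul_le_of_le_one_left (norm_nonneg _) hW

/-- Diagonal entries are dominated by the trace norm. -/
lemma sum_norm_inner_le_traceNorm {u : H →L[ℂ] H} (hu : traceNorm u ≠ ∞) {ι : Type*} {e : ι → H}
    (he : Orthonormal ℂ e) (F : Finset ι) :
    ∑ i ∈ F, ‖⟪e i, u (e i)⟫_ℂ‖ ≤ (traceNorm u).toReal := by
  refine le_of_forall_pos_le_add fun δ hδ => ?_
  obtain ⟨ε, hε, hεδ⟩ : ∃ ε : ℝ, 0 < ε ∧ F.card * ε ≤ δ := by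
    refine ⟨δ / (F.card + 1), by positivity, ?_⟩
    rw [mul_div_assoc', div_le_iff₀ (by positivity)]
    nlinarith
  obtain ⟨W, hW, hWu⟩ := exists_contraction_norm_sub_comp_abs_le u hε
  have hP := isPositive_abs u
  set Q := CFC.sqrt (CFC.abs u)
  -- Up to an error `ε`, the entry is `⟪Q W* (e i), Q (e i)⟫`, which is at most the mean of the two
  -- squares. Writing the identity as an operator lets `sum_norm_sqrt_comp_sq_le` treat both sums.
  have hterm : ∀ i, ‖⟪e i, u (e i)⟫_ℂ‖ ≤
      (‖Q (ContinuousLinearMap.adjoint W (e i))‖ ^ 2 + ‖Q ((1 : H →L[ℂ] H) (e i))‖ ^ 2) / 2 + ε := by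
    intro i
    have h1 : ⟪e i, u (e i)⟫_ℂ = ⟪Q (ContinuousLinearMap.adjoint W (e i)), Q (e i)⟫_ℂ +
        ⟪e i, (u - W ∘L CFC.abs u) (e i)⟫_ℂ := by
      rw [(isPositive_sqrt (CFC.abs u)).inner_left_eq_inner_right, sqrt_apply_sqrt_apply hP,
        ContinuousLinearMap.adjoint_inner_left, ← inner_add_right]
      simp
    have h2 : ‖⟪e i, (u - W ∘L CFC.abs u) (e i)⟫_ℂ‖ ≤ ε := by
      refine (norm_inner_le_norm _ _).trans ?_
      rw [he.1 i, one_mul]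
      refine (ContinuousLinearMap.le_opNorm _ _).trans ?_
      rwa [he.1 i, mul_one]
    have h3 := norm_inner_le_norm (𝕜 := ℂ) (Q (ContinuousLinearMap.adjoint W (e i))) (Q (e i))
    have h4 := two_mul_le_add_sq ‖Q (ContinuousLinearMap.adjoint W (e i))‖ ‖Q (e i)‖
    have h5 := norm_add_le ⟪Q (ContinuousLinearMap.adjoint W (e i)), Q (e i)⟫_ℂ
      ⟪e i, (u - W ∘L CFC.abs u) (e i)⟫_ℂ
    rw [← h1] at h5
    rw [one_apply_eq_self]
    linarith
  have hA := sum_norm_sqrt_comp_sq_le hP hu (W := ContinuousLinearMap.adjoint W)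
    (by rwa [LinearIsometryEquiv.norm_map]) he F
  have hB := sum_norm_sqrt_comp_sq_le hP hu (W := 1) ContinuousLinearMap.norm_id_le he F
  calc ∑ i ∈ F, ‖⟪e i, u (e i)⟫_ℂ‖
      ≤ ∑ i ∈ F, ((‖Q (ContinuousLinearMap.adjoint W (e i))‖ ^ 2 +
          ‖Q ((1 : H →L[ℂ] H) (e i))‖ ^ 2) / 2 + ε) := Finset.sum_le_sum fun i _ => hterm i
    _ = (∑ i ∈ F, ‖Q (ContinuousLinearMap.adjoint W (e i))‖ ^ 2 +
          ∑ i ∈ F, ‖Q ((1 : H →L[ℂ] H) (e i))‖ ^ 2) / 2 + F.card * ε := by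
        rw [Finset.sum_add_distrib, ← Finset.sum_div, Finset.sum_add_distrib, Finset.sum_const,
          nsmul_eq_mul]
    _ ≤ (traceNorm u).toReal + δ := by
        change _ ≤ (posTrace (CFC.abs u)).toReal + δ
        linarith

end TraceNorm

/-! ### Balls in the operator spaces -/

section OperatorBalls

variable {H : Type*} [NormedAddCommGroup H] [InnerProductSpace ℂ H] [CompleteSpace H]

/-- If `ω` is diagonal in the Hilbert basis `b`, cutting its eigenvalues at the level `s` costs
`excess l s` in the trace norm. -/
lemma exists_truncation {u : Type*} (b : HilbertBasis u ℂ H) {ω : H →L[ℂ] H} (hω : IsDensityOp ω)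
    {l : u → ℝ} (hl : ∀ i, ω (b i) = (l i : ℂ) • b i) (h0 : ∀ i, 0 ≤ l i) (h1 : HasSum l 1)
    {s : ℝ≥0} (hs : 0 < s) :
    ∃ z : H →L[ℂ] H, IsTraceClass z ∧ ‖z‖ ≤ s ∧
      traceNorm (z - ω) = ENNReal.ofReal (excess l s) := by
  classical
  have hfin := finite_setOf_le h1.summable (NNReal.coe_pos.2 hs)
  -- The part of `ω` above level `s`; the sum is finite because `s > 0`.
  set A : H →L[ℂ] H :=
    ∑ i ∈ hfin.toFinset, ((l i - s : ℝ) : ℂ) • InnerProductSpace.rankOne ℂ (b i) (b i)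
  have hA : A.IsPositive := by
    refine ContinuousLinearMap.isPositive_sum _ fun i hi => ?_
    refine (InnerProductSpace.isPositive_rankOne_self (b i)).smul_of_nonneg ?_
    have : (s : ℝ) ≤ l i := by simpa using hi
    exact RCLike.ofReal_nonneg.2 (sub_nonneg.2 this)
  have hAb : ∀ j, A (b j) = ((max 0 (l j - s) : ℝ) : ℂ) • b j := fun j => by
    have h2 : ∀ i, ⟪b i, b j⟫_ℂ = if i = j then 1 else 0 :=
      fun i => orthonormal_iff_ite.1 b.orthonormal i j
    by_cases hj : (s : ℝ) ≤ l j
    · simp [A, h2, hj]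
    · have h3 := (not_le.1 hj).le
      simp [A, h2, hj, h3]
  have hzb : ∀ j, (ω - A) (b j) = ((min (l j) s : ℝ) : ℂ) • b j := fun j => by
    rw [sub_apply, hl, hAb, ← sub_smul, ← Complex.ofReal_sub]
    congr 2
    rcases le_total (l j) s with h | h <;> simp [h]
  have hzsymm : ((ω - A : H →L[ℂ] H) : H →ₗ[ℂ] H).IsSymmetric :=
    hω.isPositive.isSymmetric.sub hA.isSymmetric
  have hm : ∀ j, 0 ≤ min (l j) s := fun j => le_min (h0 j) s.coe_nonneg
  have hz := isPositive_of_diagonal b hzsymm hzb hm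
  refine ⟨ω - A, ?_, ?_, ?_⟩
  · rw [IsTraceClass, traceNorm_of_isPositive hz, posTrace_of_diagonal b hz hzb]
    refine lt_of_le_of_lt ?_ (ENNReal.one_lt_top)
    rw [← hω.trace_eq_one, posTrace_of_diagonal b hω.isPositive hl]
    exact ENNReal.tsum_le_tsum fun i => ENNReal.ofReal_le_ofReal (min_le_left _ _)
  · refine norm_le_of_diagonal b hzsymm hzb s.coe_nonneg fun j => ?_
    rw [abs_of_nonneg (hm j)]
    exact min_le_right _ _
  · rw [sub_sub_cancel_left, traceNorm, CFC.abs_neg, ← traceNorm, traceNorm_of_isPositive hA,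
      posTrace_of_diagonal b hA hAb, excess,
      ENNReal.ofReal_tsum_of_nonneg (fun _ => le_max_left _ _) (summable_excess h0 h1.summable s)]

/-- The diagonal entries of `c` are at most `r` in modulus, so those of `a` must account for at
least `l i - r`. -/
lemma excess_le_traceNorm {u : Type*} (b : HilbertBasis u ℂ H) {ω a c : H →L[ℂ] H} {l : u → ℝ}
    (hl : ∀ i, ω (b i) = (l i : ℂ) • b i) (h0 : ∀ i, 0 ≤ l i) (h1 : HasSum l 1)
    (hac : ω = c - a) (ha : traceNorm a ≠ ∞) {r : ℝ≥0} (hc : ‖c‖ ≤ r) :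
    excess l r ≤ (traceNorm a).toReal := by
  refine (summable_excess h0 h1.summable r).tsum_le_of_sum_le fun F => ?_
  refine le_trans (Finset.sum_le_sum fun i _ => ?_) (sum_norm_inner_le_traceNorm ha b.orthonormal F)
  refine max_le (norm_nonneg _) ?_
  have h2 : ‖⟪b i, c (b i)⟫_ℂ‖ ≤ r := by
    refine (norm_inner_le_norm _ _).trans ?_
    rw [b.orthonormal.1 i, one_mul]
    refine (ContinuousLinearMap.le_opNorm _ _).trans ?_
    rwa [b.orthonormal.1 i, mul_one]
  have h3 : l i ≤ ‖⟪b i, c (b i)⟫_ℂ - ⟪b i, a (b i)⟫_ℂ‖ := by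
    rw [← inner_sub_right, ← sub_apply, ← hac, ← re_inner_self_of_diagonal b hl i]
    exact RCLike.re_le_norm _
  have h4 := norm_sub_le ⟪b i, c (b i)⟫_ℂ ⟪b i, a (b i)⟫_ℂ
  linarith

lemma IsDensityOp.mem_opU_iff {u : Type*} (b : HilbertBasis u ℂ H) {ω : H →L[ℂ] H}
    (hω : IsDensityOp ω) {l : u → ℝ} (hl : ∀ i, ω (b i) = (l i : ℂ) • b i) (h0 : ∀ i, 0 ≤ l i)
    (h1 : HasSum l 1) (r₁ r : ℝ≥0) :
    (r₁, r) ∈ opU ω ↔ r₁ = 0 ∨ r = 0 ∨ (r₁ : ℝ) ≤ excess l r := by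
  constructor
  · intro hU
    by_contra! h
    obtain ⟨-, hr, hex⟩ := h
    obtain ⟨s, hs0, hsr, hs⟩ := exists_lt_excess_lt h0 h1.summable (pos_iff_ne_zero.2 hr) hex
    obtain ⟨z, hz, hzs, hzω⟩ := exists_truncation b hω hl h0 h1 hs0
    have hzero : IsTraceClass (0 : H →L[ℂ] H) := by
      simp [IsTraceClass, traceNorm, posTrace, diagSum]
    refine Set.eq_empty_iff_forall_notMem.1 (hU ω 0 hω.isTraceClass hzero (sub_zero ω)) z
      ⟨⟨hz, ?_⟩, ?_⟩
    · rw [hzω, ← ENNReal.ofReal_coe_nnreal]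
      exact (ENNReal.ofReal_lt_ofReal_iff_of_nonneg (excess_nonneg _)).2 hs
    · rw [mem_ball_zero_iff]
      exact hzs.trans_lt (NNReal.coe_lt_coe.2 hsr)
  · intro h x y _ _ hxy
    refine Set.eq_empty_iff_forall_notMem.2 fun z hz => ?_
    obtain ⟨⟨-, hz1⟩, hz2⟩ := hz
    rw [mem_ball_iff_norm] at hz2
    rcases h with rfl | rfl | h
    · simp at hz1
    · exact hz2.not_ge (norm_nonneg _)
    · have h2 := excess_le_traceNorm b hl h0 h1 (a := z - x) (c := z - y)
        (by rw [sub_sub_sub_cancel_left, hxy]) (hz1.trans ENNReal.coe_lt_top).ne hz2.le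
      have h3 := (ENNReal.toReal_lt_toReal (hz1.trans ENNReal.coe_lt_top).ne
        ENNReal.coe_ne_top).2 hz1
      exact h3.not_ge (h.trans h2)

theorem IsDensityOp.isExplicitlyGiven {ω : H →L[ℂ] H} (hω : IsDensityOp ω) :
    IsExplicitlyGiven (opU ω) (eigenFamily ω) ‖ω‖₊ := by
  have htop : posTrace ω ≠ ∞ := by simp [hω.trace_eq_one]
  have hsymm := hω.isPositive.isSymmetric
  obtain ⟨u, b, f, l, hf, hlf, hl0, hl⟩ :=
    exists_eigenbasis hsymm (isCompactOperator_of_posTrace_ne_top hω.isPositive htop)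
  have h0 : ∀ i, 0 ≤ l i := fun i => by
    rw [← re_inner_self_of_diagonal b hl i]
    exact hω.isPositive.re_inner_nonneg_right _
  have h1 : HasSum l 1 := by
    simpa [hω.trace_eq_one, re_inner_self_of_diagonal b hl] using
      hasSum_re_inner_posTrace b hω.isPositive htop
  have hlf' : l ∘ f = eigenFamily ω := funext hlf
  have h1' : HasSum (eigenFamily ω) 1 := hlf' ▸ (hf.hasSum_iff hl0).2 h1
  -- Indices outside the range of `f` carry eigenvalue `0` and add `max 0 (-r) = 0`.
  have hex : ∀ r : ℝ≥0, excess (eigenFamily ω) r = excess l r := fun r => by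
    rw [← hlf']
    refine hf.tsum_eq (f := fun i => max 0 (l i - r)) fun i hi => ?_
    by_contra hif
    exact hi (by simp [hl0 i hif])
  refine isExplicitlyGiven_of_mem_iff (fun k => hlf k ▸ h0 _) h1' ?_
    fun r₁ r => by rw [hex, hω.mem_opU_iff b hl h0 h1]
  obtain ⟨i, hi, hmax⟩ := exists_isGreatest_range h0 h1
  have hnorm : ‖ω‖ = l i := by
    refine le_antisymm (norm_le_of_diagonal b hsymm hl hi.le fun j => ?_) ?_
    · rw [abs_of_nonneg (h0 j)]
      exact hmax j
    · have h2 := ω.le_opNorm (b i)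
      rwa [hl, norm_smul, Complex.norm_real, Real.norm_of_nonneg hi.le, b.orthonormal.1 i, mul_one,
        mul_one] at h2
  rw [coe_nnnorm, hnorm]
  -- The largest eigenvalue is positive, so it belongs to the list of nonzero eigenvalues.
  obtain ⟨k, rfl⟩ : i ∈ Set.range f := by
    by_contra h
    exact hi.ne' (hl0 i h)
  exact ⟨⟨k, (hlf k).symm⟩, by rintro _ ⟨k', rfl⟩; exact hlf k' ▸ hmax _⟩

end OperatorBalls

end EntropyNote

end

theorem mainTheorem1 {𝕜 : Type*} [RCLike 𝕜]
    {H : Type*} [NormedAddCommGroup H] [InnerProductSpace ℂ H] [CompleteSpace H]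
    [TopologicalSpace.SeparableSpace H] :
    (∀ ω : ℕ → ℝ, EntropyNote.IsProbSeq ω →
      ∃ h : Memℓp ω ∞,
        EntropyNote.IsExplicitlyGiven (EntropyNote.seqU 𝕜 ω) ω
          ‖(⟨ω, h⟩ : lp (fun _ : ℕ => ℝ) ∞)‖₊) ∧
    (∀ ω : H →L[ℂ] H, EntropyNote.IsDensityOp ω →
      EntropyNote.IsExplicitlyGiven (EntropyNote.opU ω) (EntropyNote.eigenFamily ω) ‖ω‖₊) :=
  ⟨fun _ hω => hω.isExplicitlyGiven, fun _ hω => hω.isExplicitlyGiven⟩
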